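/- Let $\mathbb R^{1,1}=\{x+jy : x,y\in\mathbb R\}$, $j^2=1$, be the algebra of split complex numbers, with the Euclidean topology of $\mathbb R^2$, and put $$\partial^+_{1,1}=\frac12\Bigl(\frac{\partial}{\partial x}-j\frac{\partial}{\partial y}\Bigr),\qquad dZ=dx+j\,dy .$$ Let $U\subset\mathbb R^{1,1}$ be a bounded open set with piecewise smooth boundary: $\partial U$ is a finite union of smooth regular arcs, parametrized smoothly with nowhere vanishing velocity on compact intervals, which are disjoint and without self-intersections except that end points may coincide, and at each interior point of an arc there is a nonzero vector perpendicular (in the Euclidean sense) to the arc that points outside of $U$. Give $\partial U$ its canonical orientation: at an interior point $p$ of an arc, a tangent vector $\tau_p\neq0$ of $\partial U$ points in the positive direction if and only if, for a nonzero vector $n_p$ perpendicular to $T_p\partial U$ and pointing outside of $U$, the basis $\{n_p,\tau_p\}$ has the same orientation as $\{1,j\}$. Let $V$ be an open neighborhood of the closure $\overline U$ and let $F:V\to\mathbb R^{1,1}$ be a smooth function such that $\partial^+_{1,1}F=0$ on $V$. Then $$\int_{\partial U}F\,dZ=0 .$$ -/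

import Mathlib

open Set Filter Topology
open scoped ContDiff unitInterval

noncomputable section

/-- The algebra `ℝ^{1,1}` of split complex numbers `x + j y` with `j ^ 2 = 1`;
the coordinates of `Z` are `x = Z.re` and `y = Z.im`. -/
abbrev SplitComplex : Type := QuadraticAlgebra ℝ 1 0

namespace SplitComplex

/-- The unit `j`. -/
def j : SplitComplex := ⟨0, 1⟩

theorem j_mul_j : j * j = 1 := by
  ext <;> simp [j, QuadraticAlgebra.re_one, QuadraticAlgebra.im_one]

/-- The identification of the underlying plane `ℝ²` with the Euclidean plane. -/
def toEuclidean : SplitComplex →ₗ[ℝ] EuclideanSpace ℝ (Fin 2) where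
  toFun Z := !₂[Z.re, Z.im]
  map_add' Z W := by ext i; fin_cases i <;> simp
  map_smul' c Z := by ext i; fin_cases i <;> simp

theorem toEuclidean_injective : Function.Injective toEuclidean := by
  intro Z W h
  have h0 := congrArg (fun v => v 0) h
  have h1 := congrArg (fun v => v 1) h
  ext
  · simpa [toEuclidean] using h0
  · simpa [toEuclidean] using h1

/-- `ℝ^{1,1}` carries the Euclidean norm `‖x + j y‖ = √(x² + y²)` and its topology. -/
instance : NormedAddCommGroup SplitComplex :=
  NormedAddCommGroup.induced SplitComplex (EuclideanSpace ℝ (Fin 2)) toEuclidean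
    toEuclidean_injective

instance : NormedSpace ℝ SplitComplex :=
  NormedSpace.induced ℝ SplitComplex (EuclideanSpace ℝ (Fin 2)) toEuclidean

theorem norm_eq (Z : SplitComplex) : ‖Z‖ = √(Z.re ^ 2 + Z.im ^ 2) := by
  change ‖toEuclidean Z‖ = _
  simp [toEuclidean, EuclideanSpace.norm_eq]

instance : CompleteSpace SplitComplex := FiniteDimensional.complete ℝ SplitComplex

/-- The operator `∂⁺ = (1/2) (∂/∂x - j ∂/∂y)`. -/
def dPlus (F : SplitComplex → SplitComplex) (Z : SplitComplex) : SplitComplex :=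
  (1 / 2 : ℝ) • (lineDeriv ℝ F Z 1 - j * lineDeriv ℝ F Z j)

/-- The `ℝ^{1,1}`-valued one-form `dZ = dx + j dy`. -/
def dZ : SplitComplex →L[ℝ] SplitComplex :=
  LinearMap.toContinuousLinearMap
    ((QuadraticAlgebra.reₗ (1 : ℝ) 0).smulRight 1 + (QuadraticAlgebra.imₗ (1 : ℝ) 0).smulRight j)

/-- The one-form `F dZ`. -/
def formMulDZ (F : SplitComplex → SplitComplex) (Z : SplitComplex) :
    SplitComplex →L[ℝ] SplitComplex :=
  LinearMap.toContinuousLinearMap (LinearMap.mulLeft ℝ (F Z) ∘ₗ dZ.toLinearMap)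

/-- `n` is a nonzero vector, perpendicular to `τ` in the Euclidean plane, which points outside
of `U` at the point `p`. -/
structure IsOutwardNormal (U : Set SplitComplex) (p τ n : SplitComplex) : Prop where
  ne_zero : n ≠ 0
  perp : n.re * τ.re + n.im * τ.im = 0
  outside : ∀ᶠ s in 𝓝[>] (0 : ℝ), p + s • n ∉ U

/-- The pair `{n, τ}` is a basis with the same orientation as `{1, j}`. -/
def PositivelyOriented (n τ : SplitComplex) : Prop :=
  0 < n.re * τ.im - n.im * τ.re

/-- The canonical orientation of `∂U`: a tangent vector `τ` of `∂U` at a smooth point `p` points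
in the positive direction if `{n, τ}` is positively oriented for an outward normal `n`. -/
def IsPositiveDirection (U : Set SplitComplex) (p τ : SplitComplex) : Prop :=
  ∃ n, IsOutwardNormal U p τ n ∧ PositivelyOriented n τ

/-- The velocity of a path at time `t ∈ [0, 1]` (one-sided at the end points). -/
def velocity {p q : SplitComplex} (γ : Path p q) (t : ℝ) : SplitComplex :=
  derivWithin γ.extend I t

/-- A presentation of `∂U` as a piecewise smooth curve: `∂U` is the union of finitely many regular
smooth arcs (parametrized in any direction). The arcs may share end points, and an arc may be a loop
at its end point, but they do not meet otherwise. At every interior point of an arc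
there is a normal vector that points outside of `U`. -/
structure PiecewiseSmoothBoundary (U : Set SplitComplex) where
  /-- the number of arcs -/
  card : ℕ
  /-- the initial points of the arcs -/
  source : Fin card → SplitComplex
  /-- the final points of the arcs -/
  target : Fin card → SplitComplex
  /-- the arcs -/
  arc : ∀ i, Path (source i) (target i)
  smooth : ∀ i, ContDiffOn ℝ ∞ (arc i).extend I
  regular : ∀ i, ∀ t ∈ I, velocity (arc i) t ≠ 0
  iUnion_range : ⋃ i, range (arc i) = frontier U
  simple : ∀ i k, ∀ s t : I, (t : ℝ) ∈ Ioo (0 : ℝ) 1 → arc i t = arc k s → i = k ∧ t = s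
  exists_outward : ∀ i, ∀ t : I, (t : ℝ) ∈ Ioo (0 : ℝ) 1 →
    ∃ n, IsOutwardNormal U (arc i t) (velocity (arc i) t) n

namespace PiecewiseSmoothBoundary

variable {U : Set SplitComplex}

open Classical in
/-- The sign that compares the parametrization of the `i`-th arc with the canonical orientation
of `∂U`: it is `1` if the velocity points in the positive direction, and `-1` otherwise. -/
def orientationSign (B : PiecewiseSmoothBoundary U) (i : Fin B.card) : ℝ :=
  if ∀ t : I, (t : ℝ) ∈ Ioo (0 : ℝ) 1 →
    IsPositiveDirection U (B.arc i t) (velocity (B.arc i) t) then 1 else -1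

/-- The integral of `F dZ` over `∂U` with its canonical orientation. -/
def boundaryIntegral (B : PiecewiseSmoothBoundary U) (F : SplitComplex → SplitComplex) :
    SplitComplex :=
  ∑ i, B.orientationSign i • curveIntegral (formMulDZ F) (B.arc i)

end PiecewiseSmoothBoundary

end SplitComplex

end

/-!
For `ε = ±1` the map `χ (x + j y) = x + ε y` is a character of the algebra, and the two characters
separate points. The equation `∂⁺ F = 0` says that `a = χ ∘ F` is constant along the null lines of
direction `ε - j`, the kernel of `χ`, and `χ (F dZ) = a χ(dZ)`, so it suffices that the integral of
`a χ(dZ)` over `∂U` vanishes. By the area formula this integral is the integral over `c ∈ ℝ` of the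
sum of `± a` over the points where `∂U` meets the null line `χ = c`. For almost every `c` the line
crosses finitely many arcs, at interior points and transversally. Then the summands are, up to a
common sign, the jumps along the line of the function equal to `a` in `U` and to `0` elsewhere; this
function is locally constant between the jumps and vanishes far away, so the sum is `0`.
-/

/-! ### The area formula -/

section AreaFormula

open MeasureTheory Module
open scoped NNReal

/-- The sum of the values of `g` over the fiber of `f|ₛ` above `y`, with value `0` if this sum does
not converge unconditionally. -/
noncomputable def fiberSum {X Y F : Type*} [AddCommMonoid F] [TopologicalSpace F] (f : X → Y)
    (s : Set X) (g : X → F) (y : Y) : F :=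
  ∑' x : ↥(s ∩ f ⁻¹' {y}), g x

section Fibers

variable {X Y F : Type*} [AddCommMonoid F] [TopologicalSpace F] {f : X → Y} {s : Set X}

theorem fiberSum_apply_of_injOn (hf : InjOn f s) (g : X → F) {x : X} (hx : x ∈ s) :
    fiberSum f s g (f x) = g x := by
  have hfiber : s ∩ f ⁻¹' {f x} = {x} :=
    Subset.antisymm (fun z hz => hf hz.1 hx hz.2) (singleton_subset_iff.2 ⟨hx, rfl⟩)
  rw [fiberSum, hfiber, tsum_singleton]

theorem fiberSum_eq_zero_of_notMem_image (g : X → F) {y : Y} (hy : y ∉ f '' s) :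
    fiberSum f s g y = 0 := by
  have hfiber : s ∩ f ⁻¹' {y} = ∅ :=
    eq_empty_of_forall_notMem fun x hx => hy ⟨x, hx⟩
  rw [fiberSum, hfiber, tsum_empty]

theorem fiberSum_eq_indicator (g : X → F) :
    fiberSum f s g = (f '' s).indicator (fiberSum f s g) :=
  (indicator_eq_self.2 fun _ hy => not_imp_comm.1 (fiberSum_eq_zero_of_notMem_image g) hy).symm

theorem fiberSum_congr_set {t : Set X} {y : Y} (h : s ∩ f ⁻¹' {y} = t ∩ f ⁻¹' {y}) (g : X → F) :
    fiberSum f s g y = fiberSum f t g y := by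
  rw [fiberSum, fiberSum, h]

theorem norm_fiberSum_of_injOn {F : Type*} [NormedAddCommGroup F] (hf : InjOn f s) (g : X → F)
    (y : Y) : ‖fiberSum f s g y‖ = fiberSum f s (fun x => ‖g x‖) y := by
  by_cases hy : y ∈ f '' s
  · obtain ⟨x, hx, rfl⟩ := hy
    rw [fiberSum_apply_of_injOn hf g hx, fiberSum_apply_of_injOn hf _ hx]
  · rw [fiberSum_eq_zero_of_notMem_image g hy, fiberSum_eq_zero_of_notMem_image _ hy, norm_zero]

theorem fiberSum_iUnion_of_injOn {ι : Type*} {A : ι → Set X}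
    (hA : Pairwise (Function.onFun Disjoint A)) (hf : ∀ n, InjOn f (A n)) (g : X → F) (y : Y) :
    fiberSum f (⋃ n, A n) g y = ∑' n, fiberSum f (A n) g y := by
  choose index hindex using fun x : ↥((⋃ n, A n) ∩ f ⁻¹' {y}) => mem_iUnion.1 x.2.1
  have hvalue : ∀ x : ↥((⋃ n, A n) ∩ f ⁻¹' {y}), fiberSum f (A (index x)) g y = g x := by
    intro x
    conv_lhs => rw [← show f x = y from x.2.2]
    exact fiberSum_apply_of_injOn (hf _) g (hindex x)
  have hinj : Function.Injective index := by
    intro x z hxz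
    refine Subtype.ext (hf (index x) (hindex x) (hxz ▸ hindex z) ?_)
    exact (show f x = y from x.2.2).trans (show f z = y from z.2.2).symm
  have hsupport : Function.support (fun n => fiberSum f (A n) g y) ⊆ range index := by
    intro n hn
    obtain ⟨x, hx, rfl⟩ := not_imp_comm.1 (fiberSum_eq_zero_of_notMem_image g) hn
    refine ⟨⟨x, mem_iUnion.2 ⟨n, hx⟩, rfl⟩, ?_⟩
    by_contra hne
    exact disjoint_left.1 (hA hne) (hindex _) hx
  rw [← hinj.tsum_eq hsupport]
  exact tsum_congr fun x => (hvalue x).symm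

end Fibers

theorem integrable_tsum_of_summable_integral_norm {α F : Type*} [MeasurableSpace α]
    {μ : Measure α} [NormedAddCommGroup F] [CompleteSpace F] {g : ℕ → α → F}
    (hg : ∀ n, Integrable (g n) μ) (hsum : Summable fun n => ∫ x, ‖g n x‖ ∂μ) :
    Integrable (fun x => ∑' n, g n x) μ := by
  have hfinite : ∫⁻ x, ∑' n, ‖g n x‖ₑ ∂μ < ⊤ := by
    rw [lintegral_tsum fun n => (hg n).1.enorm]
    simp only [← ofReal_integral_norm_eq_lintegral_enorm (hg _)]
    rw [← ENNReal.ofReal_tsum_of_nonneg (fun n => integral_nonneg fun x => norm_nonneg _) hsum]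
    exact ENNReal.ofReal_lt_top
  have hsummable : ∀ᵐ x ∂μ, Summable fun n => g n x := by
    filter_upwards [ae_lt_top' (AEMeasurable.tsum fun n => (hg n).1.enorm) hfinite.ne]
      with x hx
    exact .of_norm (tsum_enorm_ne_top_iff_summable_norm.1 hx.ne)
  refine ⟨aestronglyMeasurable_of_tendsto_ae atTop
    (fun n => Finset.aestronglyMeasurable_fun_sum (Finset.range n) fun k _ => (hg k).1) ?_, ?_⟩
  · filter_upwards [hsummable] with x hx using hx.hasSum.tendsto_sum_nat
  · exact (lintegral_mono fun x => enorm_tsum_le_tsum_enorm).trans_lt hfinite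

variable {E F : Type*} [NormedAddCommGroup E] [NormedSpace ℝ E] [FiniteDimensional ℝ E]
  [NormedAddCommGroup F] {s : Set E} {f : E → E} {f' : E → E →L[ℝ] E}

theorem exists_pos_forall_approximatesLinearOn_injOn (A : E →L[ℝ] E) (hA : A.det ≠ 0) :
    ∃ r : ℝ≥0, r ≠ 0 ∧ ∀ (f : E → E) (s : Set E), ApproximatesLinearOn f A s r → InjOn f s := by
  set e := A.toContinuousLinearEquivOfDetNeZero hA
  rcases subsingleton_or_nontrivial E with hE | hE
  · exact ⟨1, one_ne_zero, fun f s _ x _ y _ _ => Subsingleton.elim x y⟩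
  · have hpos : 0 < ‖(e.symm : E →L[ℝ] E)‖₊⁻¹ := inv_pos.2 e.nnnorm_symm_pos
    refine ⟨‖(e.symm : E →L[ℝ] E)‖₊⁻¹ / 2, (half_pos hpos).ne', fun f s hfs => ?_⟩
    exact ApproximatesLinearOn.injOn (f' := e) hfs (Or.inr (NNReal.half_lt_self hpos.ne'))

variable [MeasurableSpace E] [BorelSpace E]

theorem exists_measurable_partition_injOn (hs : MeasurableSet s)
    (hf' : ∀ x ∈ s, HasFDerivWithinAt f (f' x) s x) (hdet : ∀ x ∈ s, (f' x).det ≠ 0) :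
    ∃ A : ℕ → Set E, (∀ n, MeasurableSet (A n)) ∧ Pairwise (Function.onFun Disjoint A) ∧
      ⋃ n, A n = s ∧ ∀ n, InjOn f (A n) := by
  classical
  rcases s.eq_empty_or_nonempty with rfl | hne
  · exact ⟨fun _ => ∅, fun _ => .empty, fun _ _ _ => disjoint_bot_left, by simp, fun _ => by simp⟩
  choose! r hr hinj using exists_pos_forall_approximatesLinearOn_injOn (E := E)
  obtain ⟨t, A, htd, htm, hst, happrox, hA⟩ :=
    exists_partition_approximatesLinearOn_of_hasFDerivWithinAt f s f' hf'
      (fun A => if A.det = 0 then 1 else r A) fun A => by split_ifs with h <;> simp [hr A, h]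
  refine ⟨fun n => s ∩ t n, fun n => hs.inter (htm n), fun m n hmn => ?_, ?_, fun n => ?_⟩
  · exact (htd hmn).mono inter_subset_right inter_subset_right
  · rw [← inter_iUnion, inter_eq_left.2 hst]
  · obtain ⟨x, hx, hAx⟩ := hA hne n
    have hAn : (A n).det ≠ 0 := hAx ▸ hdet x hx
    have happrox_n := happrox n
    rw [if_neg hAn] at happrox_n
    exact hinj (A n) hAn f _ happrox_n

variable {μ : Measure E} [μ.IsAddHaarMeasure] [NormedSpace ℝ F] {g : E → F}

theorem integrable_fiberSum_iff_of_injOn (hs : MeasurableSet s)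
    (hf' : ∀ x ∈ s, HasFDerivWithinAt f (f' x) s x) (hf : InjOn f s) :
    Integrable (fiberSum f s g) μ ↔ IntegrableOn (fun x => |(f' x).det| • g x) s μ := by
  rw [fiberSum_eq_indicator, integrable_indicator_iff (measurable_image_of_fderivWithin hs hf' hf),
    integrableOn_image_iff_integrableOn_abs_det_fderiv_smul μ hs hf' hf]
  exact integrableOn_congr_fun (fun x hx => by simp only [fiberSum_apply_of_injOn hf g hx]) hs

theorem integral_fiberSum_of_injOn (hs : MeasurableSet s)
    (hf' : ∀ x ∈ s, HasFDerivWithinAt f (f' x) s x) (hf : InjOn f s) :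
    ∫ y, fiberSum f s g y ∂μ = ∫ x in s, |(f' x).det| • g x ∂μ := by
  rw [fiberSum_eq_indicator, integral_indicator (measurable_image_of_fderivWithin hs hf' hf),
    integral_image_eq_integral_abs_det_fderiv_smul μ hs hf' hf]
  exact setIntegral_congr_fun hs fun x hx => by simp only [fiberSum_apply_of_injOn hf g hx]

theorem integrable_fiberSum_and_integral_fiberSum_of_det_ne_zero [CompleteSpace F]
    (hs : MeasurableSet s) (hf' : ∀ x ∈ s, HasFDerivWithinAt f (f' x) s x)
    (hdet : ∀ x ∈ s, (f' x).det ≠ 0) (hg : IntegrableOn (fun x => |(f' x).det| • g x) s μ) :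
    Integrable (fiberSum f s g) μ ∧
      ∫ y, fiberSum f s g y ∂μ = ∫ x in s, |(f' x).det| • g x ∂μ := by
  obtain ⟨A, hA, hdisj, rfl, hinj⟩ := exists_measurable_partition_injOn hs hf' hdet
  have hA' : ∀ n, ∀ x ∈ A n, HasFDerivWithinAt f (f' x) (A n) x := fun n x hx =>
    (hf' x (mem_iUnion_of_mem n hx)).mono (subset_iUnion A n)
  have hint : ∀ n, Integrable (fiberSum f (A n) g) μ := fun n =>
    (integrable_fiberSum_iff_of_injOn (hA n) (hA' n) (hinj n)).2 (hg.mono_set (subset_iUnion A n))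
  have hnorm : Summable fun n => ∫ y, ‖fiberSum f (A n) g y‖ ∂μ := by
    refine (hasSum_integral_iUnion hA hdisj hg.norm).summable.congr fun n => ?_
    simp only [norm_fiberSum_of_injOn (hinj n), norm_smul, Real.norm_eq_abs, abs_abs]
    exact (integral_fiberSum_of_injOn (hA n) (hA' n) (hinj n)).symm
  have hsplit : fiberSum f (⋃ n, A n) g = fun y => ∑' n, fiberSum f (A n) g y :=
    funext (fiberSum_iUnion_of_injOn hdisj hinj g)
  rw [hsplit]
  refine ⟨integrable_tsum_of_summable_integral_norm hint hnorm, ?_⟩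
  rw [← integral_tsum_of_summable_integral_norm hint hnorm, integral_iUnion hA hdisj hg]
  exact tsum_congr fun n => integral_fiberSum_of_injOn (hA n) (hA' n) (hinj n)

theorem exists_measurable_subset_det_ne_zero (μ : Measure E) [μ.IsAddHaarMeasure]
    (hs : MeasurableSet s) (hf' : ∀ x ∈ s, HasFDerivWithinAt f (f' x) s x) :
    ∃ t ⊆ s, MeasurableSet t ∧ (∀ x ∈ t, (f' x).det ≠ 0) ∧ (∀ᵐ x ∂μ, x ∈ s \ t → (f' x).det = 0) ∧
      μ (f '' (s \ t)) = 0 := by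
  have hnull : NullMeasurableSet ((fun x => (f' x).det) ⁻¹' {0}ᶜ ∩ s) μ := by
    have hdet : AEMeasurable (fun x => (f' x).det) (μ.restrict s) :=
      ContinuousLinearMap.continuous_det.measurable.comp_aemeasurable
        (aemeasurable_fderivWithin μ hs hf')
    exact (nullMeasurableSet_restrict hs.nullMeasurableSet).1
      (hdet.nullMeasurable (measurableSet_singleton 0).compl)
  obtain ⟨t, hts, ht, hae⟩ := hnull.exists_measurable_subset_ae_eq
  set c := s ∩ (fun x => (f' x).det) ⁻¹' {0}
  have hrest : μ ((s \ t) \ c) = 0 :=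
    measure_mono_null (fun x hx => ⟨⟨fun h => hx.2 ⟨hx.1.1, h⟩, hx.1.1⟩, hx.1.2⟩ :
      (s \ t) \ c ⊆ ((fun x => (f' x).det) ⁻¹' {0}ᶜ ∩ s) \ t) (ae_le_set.1 hae.symm.le)
  refine ⟨t, fun x hx => (hts hx).2, ht, fun x hx => (hts hx).1, ?_, ?_⟩
  · filter_upwards [measure_eq_zero_iff_ae_notMem.1 hrest] with x hx hxst
    exact (not_not.1 fun hxc => hx ⟨hxst, hxc⟩ : x ∈ c).2
  · have hcritical : μ (f '' c) = 0 :=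
      addHaar_image_eq_zero_of_det_fderivWithin_eq_zero μ
        (fun x hx => (hf' x hx.1).mono inter_subset_left) fun x hx => hx.2
    have hnegligible : μ (f '' ((s \ t) \ c)) = 0 :=
      addHaar_image_eq_zero_of_differentiableOn_of_addHaar_eq_zero μ
        (fun x hx => ((hf' x hx.1.1).mono fun z hz => hz.1.1).differentiableWithinAt) hrest
    refine measure_mono_null ?_ (measure_union_null hcritical hnegligible)
    rw [← image_union]
    exact image_mono fun x hx => (em (x ∈ c)).imp id fun hxc => ⟨hx, hxc⟩

theorem integrable_fiberSum_and_integral_fiberSum [CompleteSpace F]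
    (hs : MeasurableSet s) (hf' : ∀ x ∈ s, HasFDerivWithinAt f (f' x) s x)
    (hg : IntegrableOn (fun x => |(f' x).det| • g x) s μ) :
    Integrable (fiberSum f s g) μ ∧
      ∫ y, fiberSum f s g y ∂μ = ∫ x in s, |(f' x).det| • g x ∂μ := by
  obtain ⟨t, hts, ht, hdet, hcritical, himage⟩ := exists_measurable_subset_det_ne_zero μ hs hf'
  have hae : fiberSum f s g =ᵐ[μ] fiberSum f t g := by
    filter_upwards [measure_eq_zero_iff_ae_notMem.1 himage] with y hy
    refine fiberSum_congr_set (Subset.antisymm (fun x hx => ⟨?_, hx.2⟩)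
      (inter_subset_inter_left _ hts)) g
    by_contra hxt
    exact hy ⟨x, ⟨hx.1, hxt⟩, hx.2⟩
  have hsmul : ∫ x in s, |(f' x).det| • g x ∂μ = ∫ x in t, |(f' x).det| • g x ∂μ :=
    setIntegral_eq_of_subset_of_ae_sdiff_eq_zero hs.nullMeasurableSet hts
      (hcritical.mono fun x hx hxst => by rw [hx hxst, abs_zero, zero_smul])
  obtain ⟨hint, hintegral⟩ := integrable_fiberSum_and_integral_fiberSum_of_det_ne_zero ht
    (fun x hx => (hf' x (hts hx)).mono hts) hdet (hg.mono_set hts)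
  exact ⟨hint.congr hae.symm, (integral_congr_ae hae).trans (hintegral.trans hsmul.symm)⟩

theorem integrable_fiberSum_and_integral_fiberSum_real [CompleteSpace F] {s : Set ℝ} {f f' : ℝ → ℝ}
    {g : ℝ → F} (hs : MeasurableSet s) (hf' : ∀ x ∈ s, HasDerivWithinAt f (f' x) s x)
    (hg : IntegrableOn (fun x => |f' x| • g x) s) :
    Integrable (fiberSum f s g) ∧ ∫ y, fiberSum f s g y = ∫ x in s, |f' x| • g x := by
  simpa only [ContinuousLinearMap.det_toSpanSingleton] using
    integrable_fiberSum_and_integral_fiberSum (μ := volume) (g := g) hs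
      (fun x hx => (hf' x hx).hasFDerivWithinAt)
      (by simpa only [ContinuousLinearMap.det_toSpanSingleton] using hg)

theorem ae_forall_deriv_ne_zero_of_eq {s : Set ℝ} {f f' : ℝ → ℝ}
    (hf' : ∀ x ∈ s, HasDerivWithinAt f (f' x) s x) : ∀ᵐ y, ∀ x ∈ s, f x = y → f' x ≠ 0 := by
  have hcritical : volume (f '' (s ∩ f' ⁻¹' {0})) = 0 :=
    addHaar_image_eq_zero_of_det_fderivWithin_eq_zero volume
      (fun x hx => ((hf' x hx.1).mono inter_subset_left).hasFDerivWithinAt)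
      fun x hx => (ContinuousLinearMap.det_toSpanSingleton _).trans hx.2
  filter_upwards [measure_eq_zero_iff_ae_notMem.1 hcritical] with y hy x hx hxy hzero
  exact hy ⟨x, ⟨hx, hzero⟩, hxy⟩

end AreaFormula

/-! ### Jumps of functions on the real line -/

section Jumps

variable {E : Type*} [NormedAddCommGroup E]

theorem tendsto_sub_indicator_Ioi {h : ℝ → E} {p : ℝ} {l c : E} (hleft : Tendsto h (𝓝[<] p) (𝓝 l))
    (hright : Tendsto h (𝓝[>] p) (𝓝 (l + c))) :
    Tendsto (fun x => h x - (Ioi p).indicator (fun _ => c) x) (𝓝[≠] p) (𝓝 l) := by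
  rw [← nhdsLT_sup_nhdsGT]
  refine Tendsto.sup (hleft.congr' ?_) ?_
  · filter_upwards [self_mem_nhdsWithin] with x (hx : x < p)
    simp only [indicator_of_notMem (show x ∉ Ioi p from not_lt.2 hx.le), sub_zero]
  · rw [← add_sub_cancel_right l c]
    refine (hright.sub_const c).congr' ?_
    filter_upwards [self_mem_nhdsWithin] with x hx
    rw [indicator_of_mem hx]

variable [NormedSpace ℝ E]

theorem hasDerivAt_indicator_Ioi_const {p x : ℝ} (hx : x ≠ p) (c : E) :
    HasDerivAt ((Ioi p).indicator fun _ => c) 0 x := by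
  rcases hx.lt_or_gt with hlt | hgt
  · refine (hasDerivAt_const x (0 : E)).congr_of_eventuallyEq ?_
    filter_upwards [Iio_mem_nhds hlt] with y hy
    exact indicator_of_notMem (not_lt.2 (le_of_lt hy)) _
  · refine (hasDerivAt_const x c).congr_of_eventuallyEq ?_
    filter_upwards [Ioi_mem_nhds hgt] with y hy
    exact indicator_of_mem hy _

variable [CompleteSpace E]

theorem eq_of_hasDerivAt_zero_of_exists_tendsto {k : ℝ → E} {S : Set ℝ} (hS : S.Finite)
    (hderiv : ∀ x ∉ S, HasDerivAt k 0 x) (hlim : ∀ x ∈ S, ∃ l, Tendsto k (𝓝[≠] x) (𝓝 l))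
    {a b : ℝ} (ha : a ∉ S) (hb : b ∉ S) (hab : a ≤ b) : k a = k b := by
  have hcont : Continuous (extendFrom Sᶜ k) := by
    refine continuous_extendFrom (hS.countable.dense_compl ℝ) fun x => ?_
    by_cases hx : x ∈ S
    · obtain ⟨l, hl⟩ := hlim x hx
      exact ⟨l, hl.mono_left (nhdsWithin_mono x (compl_subset_compl.2 (singleton_subset_iff.2 hx)))⟩
    · exact ⟨k x, (hderiv x hx).continuousAt.continuousWithinAt⟩
  have hext : ∀ x ∉ S, extendFrom Sᶜ k x = k x := extendFrom_extends fun x hx =>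
    (hderiv x hx).continuousAt.continuousWithinAt
  have hderiv_ext : ∀ x ∉ S, HasDerivAt (extendFrom Sᶜ k) 0 x := fun x hx =>
    (hderiv x hx).congr_of_eventuallyEq <| by
      filter_upwards [hS.isClosed.isOpen_compl.mem_nhds hx] with y hy using hext y hy
  have hintegral := MeasureTheory.integral_eq_of_hasDerivAt_off_countable_of_le (E := E) _
    (fun _ => 0) hab hS.countable hcont.continuousOn (fun x hx => hderiv_ext x hx.2) (by simp)
  rw [intervalIntegral.integral_zero, hext a ha, hext b hb] at hintegral
  exact (sub_eq_zero.1 hintegral.symm).symm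

theorem sub_eq_sum_of_hasDerivAt_zero_of_jump {ι : Type*} [Fintype ι] {pos : ι → ℝ}
    (hpos : Function.Injective pos) {h : ℝ → E} {J : ι → E}
    (hderiv : ∀ x ∉ range pos, HasDerivAt h 0 x)
    (hjump : ∀ i, ∃ l, Tendsto h (𝓝[<] pos i) (𝓝 l) ∧ Tendsto h (𝓝[>] pos i) (𝓝 (l + J i)))
    {a b : ℝ} (hab : a ≤ b) (ha : ∀ i, a < pos i) (hb : ∀ i, pos i < b) :
    h b - h a = ∑ i, J i := by
  classical
  set step : ι → ℝ → E := fun i => (Ioi (pos i)).indicator fun _ => J i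
  have hconst : h a - ∑ i, step i a = h b - ∑ i, step i b := by
    refine eq_of_hasDerivAt_zero_of_exists_tendsto (k := fun x => h x - ∑ i, step i x)
      (finite_range pos) (fun x hx => ?_) ?_ ?_ ?_ hab
    · have hsteps : HasDerivAt (fun x => ∑ i, step i x) (∑ _i : ι, (0 : E)) x :=
        .fun_sum fun i _ => hasDerivAt_indicator_Ioi_const (fun h => hx ⟨i, h.symm⟩) (J i)
      simpa only [Finset.sum_const_zero, sub_zero] using (hderiv x hx).fun_sub hsteps
    · rintro _ ⟨i, rfl⟩
      obtain ⟨l, hleft, hright⟩ := hjump i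
      have hothers : Tendsto (fun x => ∑ j ∈ Finset.univ.erase i, step j x) (𝓝[≠] pos i)
          (𝓝 (∑ j ∈ Finset.univ.erase i, step j (pos i))) :=
        tendsto_finsetSum _ fun j hj => (hasDerivAt_indicator_Ioi_const
          (hpos.ne (Finset.ne_of_mem_erase hj).symm) (J j)).continuousAt.continuousWithinAt
      refine ⟨_, ((tendsto_sub_indicator_Ioi hleft hright).sub hothers).congr fun x => ?_⟩
      rw [← Finset.add_sum_erase _ _ (Finset.mem_univ i), sub_sub]
    · exact fun ⟨i, hi⟩ => (ha i).ne' hi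
    · exact fun ⟨i, hi⟩ => (hb i).ne hi
  have hstep_a : ∑ i, step i a = 0 :=
    Finset.sum_eq_zero fun i _ => indicator_of_notMem (not_lt.2 (ha i).le) _
  have hstep_b : ∑ i, step i b = ∑ i, J i :=
    Finset.sum_congr rfl fun i _ => indicator_of_mem (hb i) _
  rw [hstep_a, hstep_b, sub_zero] at hconst
  rw [hconst, sub_sub_cancel]

end Jumps

/-! ### Open sets and level sets -/

theorem isPreconnected_subset_or_disjoint {X : Type*} [TopologicalSpace X] {P U : Set X}
    (hP : IsPreconnected P) (hU : IsOpen U) (hPU : Disjoint P (frontier U)) :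
    P ⊆ U ∨ Disjoint P U := by
  rcases (P ∩ U).eq_empty_or_nonempty with hempty | hne
  · exact Or.inr (disjoint_iff_inter_eq_empty.2 hempty)
  · refine Or.inl (hP.subset_of_closure_inter_subset hU hne fun x hx => ?_)
    by_contra hxU
    exact disjoint_left.1 hPU hx.2 (hU.frontier_eq ▸ ⟨hx.1, hxU⟩)

theorem finite_inter_preimage_singleton_of_hasDerivWithinAt {K : Set ℝ} (hK : IsCompact K)
    {f f' : ℝ → ℝ} {c : ℝ} (hf : ContinuousOn f K)
    (hf' : ∀ x ∈ K, f x = c → HasDerivWithinAt f (f' x) K x ∧ f' x ≠ 0) :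
    (K ∩ f ⁻¹' {c}).Finite := by
  by_contra hinfinite
  have hcompact : IsCompact (K ∩ f ⁻¹' {c}) := hK.of_isClosed_subset
    (hf.preimage_isClosed_of_isClosed hK.isClosed isClosed_singleton) inter_subset_left
  obtain ⟨x, ⟨hxK, hxc⟩, hacc⟩ :=
    Set.Infinite.exists_accPt_of_subset_isCompact hinfinite hcompact subset_rfl
  obtain ⟨hderiv, hne⟩ := hf' x hxK hxc
  have hneBot := accPt_principal_iff_nhdsWithin.1 hacc
  have hne_c : ∀ᶠ z in 𝓝[(K ∩ f ⁻¹' {c}) \ {x}] x, f z ≠ c :=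
    nhdsWithin_mono x (sdiff_subset_sdiff_left inter_subset_left) (hderiv.eventually_ne hne)
  obtain ⟨z, hzc, ⟨-, hz⟩, -⟩ := (hne_c.and self_mem_nhdsWithin).exists
  exact hzc hz

theorem hasLineDerivAt_indicator_zero {X E : Type*} [NormedAddCommGroup X] [NormedSpace ℝ X]
    [NormedAddCommGroup E] [NormedSpace ℝ E] {U : Set X} (hU : IsOpen U) {a : X → E} {v Z : X}
    (ha : ∀ Z ∈ U, HasLineDerivAt ℝ a 0 Z v) (hZ : Z ∉ frontier U) :
    HasLineDerivAt ℝ (U.indicator a) 0 Z v := by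
  by_cases hZU : Z ∈ U
  · exact (ha Z hZU).congr_of_eventuallyEq
      (Filter.mem_of_superset (hU.mem_nhds hZU) fun Y hY => indicator_of_mem hY a)
  · have hclosure : Z ∈ (closure U)ᶜ := fun h => hZ (hU.frontier_eq ▸ ⟨h, hZU⟩)
    have hzero : HasLineDerivAt ℝ (fun _ => (0 : E)) 0 Z v := hasDerivAt_const 0 0
    exact hzero.congr_of_eventuallyEq
      (Filter.mem_of_superset (isClosed_closure.isOpen_compl.mem_nhds hclosure)
        fun Y hY => indicator_of_notMem (fun h => hY (subset_closure h)) a)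

namespace SplitComplex

/-! ### The area form of the plane -/

/-- The real part, as a continuous linear functional. -/
noncomputable def reL : SplitComplex →L[ℝ] ℝ :=
  LinearMap.toContinuousLinearMap (QuadraticAlgebra.reₗ (1 : ℝ) 0)

/-- The imaginary part, as a continuous linear functional. -/
noncomputable def imL : SplitComplex →L[ℝ] ℝ :=
  LinearMap.toContinuousLinearMap (QuadraticAlgebra.imₗ (1 : ℝ) 0)

/-- The area form of the plane, as a linear functional of its second argument: `cross v τ` is
positive if the basis `{v, τ}` has the orientation of `{1, j}`. -/
noncomputable def cross (v : SplitComplex) : SplitComplex →L[ℝ] ℝ :=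
  v.re • imL - v.im • reL

theorem cross_apply (v τ : SplitComplex) : cross v τ = v.re * τ.im - v.im * τ.re := rfl

theorem cross_neg_left (v τ : SplitComplex) : cross (-v) τ = -cross v τ := by
  simp only [cross_apply, QuadraticAlgebra.re_neg, QuadraticAlgebra.im_neg]; ring

theorem cross_add_left (u v τ : SplitComplex) : cross (u + v) τ = cross u τ + cross v τ := by
  simp only [cross_apply, QuadraticAlgebra.re_add, QuadraticAlgebra.im_add]; ring

theorem cross_smul_left (c : ℝ) (v τ : SplitComplex) : cross (c • v) τ = c * cross v τ := by
  simp only [cross_apply, QuadraticAlgebra.re_smul, QuadraticAlgebra.im_smul, smul_eq_mul]; ring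

theorem cross_swap (v τ : SplitComplex) : cross v τ = -cross τ v := by
  simp only [cross_apply]; ring

theorem cross_self (v : SplitComplex) : cross v v = 0 := by
  rw [cross_apply]; ring

theorem cross_smul_eq (v w p : SplitComplex) :
    cross v w • p = cross v p • w + cross p w • v := by
  ext
  · simp only [cross_apply, QuadraticAlgebra.re_add, QuadraticAlgebra.re_smul, smul_eq_mul]; ring
  · simp only [cross_apply, QuadraticAlgebra.im_add, QuadraticAlgebra.im_smul, smul_eq_mul]; ring

theorem sq_re_add_sq_im_pos {τ : SplitComplex} (h : τ ≠ 0) : 0 < τ.re ^ 2 + τ.im ^ 2 := by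
  rw [← norm_pos_iff, norm_eq] at h
  exact Real.sqrt_pos.1 h

theorem cross_ne_zero_of_perp {n τ : SplitComplex} (hn : n ≠ 0) (hτ : τ ≠ 0)
    (h : n.re * τ.re + n.im * τ.im = 0) : cross n τ ≠ 0 := by
  intro hcross
  have hlagrange : (n.re * τ.re + n.im * τ.im) ^ 2 + cross n τ ^ 2 =
      (n.re ^ 2 + n.im ^ 2) * (τ.re ^ 2 + τ.im ^ 2) := by
    rw [cross_apply]; ring
  rw [h, hcross] at hlagrange
  linarith [mul_pos (sq_re_add_sq_im_pos hn) (sq_re_add_sq_im_pos hτ)]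

/-- The clockwise rotation of a vector by a right angle. -/
def rotate (τ : SplitComplex) : SplitComplex := ⟨τ.im, -τ.re⟩

theorem cross_rotate_pos {τ : SplitComplex} (h : τ ≠ 0) : 0 < cross (rotate τ) τ := by
  rw [cross_apply, rotate]
  linarith [sq_re_add_sq_im_pos h]

theorem exists_cross_eq_one {v : SplitComplex} (hv : v ≠ 0) : ∃ w, cross v w = 1 := by
  have hne : cross v (rotate v) ≠ 0 := by
    rw [cross_swap]
    exact neg_ne_zero.2 (cross_rotate_pos hv).ne'
  exact ⟨(cross v (rotate v))⁻¹ • rotate v, by rw [map_smul, smul_eq_mul, inv_mul_cancel₀ hne]⟩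

/-- The linear coordinates of the plane with respect to a basis `τ, ν`. -/
noncomputable def frame (τ ν : SplitComplex) (h : cross ν τ ≠ 0) : (ℝ × ℝ) ≃L[ℝ] SplitComplex :=
  LinearEquiv.toContinuousLinearEquiv
    { toFun := fun x => x.1 • τ + x.2 • ν
      map_add' := fun x y => by simp only [Prod.fst_add, Prod.snd_add, add_smul]; abel
      map_smul' := fun c x => by
        simp only [Prod.smul_fst, Prod.smul_snd, smul_eq_mul, mul_smul, smul_add, RingHom.id_apply]
      invFun := fun v => (cross ν v / cross ν τ, cross v τ / cross ν τ)
      left_inv := fun x => by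
        refine Prod.ext ((div_eq_iff h).2 ?_) ((div_eq_iff h).2 ?_)
        · rw [map_add, map_smul, map_smul, cross_self, smul_zero, add_zero, smul_eq_mul]
        · rw [cross_add_left, cross_smul_left, cross_smul_left, cross_self, mul_zero, zero_add]
      right_inv := fun v => by
        simp only [div_eq_inv_mul, mul_smul, ← smul_add, ← cross_smul_eq, inv_smul_smul₀ h] }

theorem frame_apply (τ ν : SplitComplex) (h : cross ν τ ≠ 0) (x : ℝ × ℝ) :
    frame τ ν h x = x.1 • τ + x.2 • ν := rfl

/-! ### Sides of a curve -/

/-- Locally at `p`, every ray that departs to the right of the direction `τ` starts outside of `U`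
and every ray that departs to the left of `τ` starts inside of `U`. -/
structure LiesLeft (U : Set SplitComplex) (p τ : SplitComplex) : Prop where
  notMem : ∀ v, 0 < cross v τ → ∀ᶠ s in 𝓝[>] (0 : ℝ), p + s • v ∉ U
  mem : ∀ v, cross v τ < 0 → ∀ᶠ s in 𝓝[>] (0 : ℝ), p + s • v ∈ U

namespace LiesLeft

variable {U : Set SplitComplex} {p τ : SplitComplex}

theorem not_liesLeft_neg (h : LiesLeft U p τ) (hτ : τ ≠ 0) : ¬LiesLeft U p (-τ) := by
  intro hneg
  have hpos := cross_rotate_pos hτ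
  obtain ⟨s, hmem, hnotMem⟩ := ((hneg.mem _ (by rwa [map_neg, neg_lt_zero])).and
    (h.notMem _ hpos)).exists
  exact hnotMem hmem

theorem isPositiveDirection (h : LiesLeft U p τ) (hτ : τ ≠ 0) : IsPositiveDirection U p τ := by
  have hpos := cross_rotate_pos hτ
  refine ⟨rotate τ, ⟨?_, ?_, h.notMem _ hpos⟩, hpos⟩
  · intro hzero
    rw [hzero, cross_apply] at hpos
    simp at hpos
  · rw [rotate]; ring

theorem not_isPositiveDirection (h : LiesLeft U p (-τ)) : ¬IsPositiveDirection U p τ := by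
  rintro ⟨n, hn, hpos⟩
  have hneg : cross n (-τ) < 0 := by rw [map_neg]; exact neg_lt_zero.2 hpos
  obtain ⟨s, hmem, hnotMem⟩ := ((h.mem n hneg).and hn.outside).exists
  exact hnotMem hmem

variable {E : Type*} [NormedAddCommGroup E] {a : SplitComplex → E}
  {v : SplitComplex}

theorem tendsto_indicator_nhdsGT_of_pos (h : LiesLeft U p τ) (hv : 0 < cross v τ) :
    Tendsto (fun s : ℝ => U.indicator a (p + s • v)) (𝓝[>] 0) (𝓝 0) :=
  tendsto_const_nhds.congr' ((h.notMem v hv).mono fun _ hs => (indicator_of_notMem hs a).symm)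

theorem tendsto_indicator_nhdsGT_of_neg (h : LiesLeft U p τ) (hv : cross v τ < 0)
    (ha : ContinuousWithinAt a U p) :
    Tendsto (fun s : ℝ => U.indicator a (p + s • v)) (𝓝[>] 0) (𝓝 (a p)) := by
  have hray : Tendsto (fun s : ℝ => p + s • v) (𝓝[>] 0) (𝓝[U] p) := by
    refine tendsto_nhdsWithin_iff.2 ⟨?_, h.mem v hv⟩
    have hcont : Continuous fun s : ℝ => p + s • v := by fun_prop
    exact (hcont.tendsto' 0 p (by rw [zero_smul, add_zero])).mono_left nhdsWithin_le_nhds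
  exact (Tendsto.comp ha hray).congr' ((h.mem v hv).mono fun _ hs => (indicator_of_mem hs a).symm)

theorem tendsto_indicator_nhdsLT {l : E}
    (h : Tendsto (fun s : ℝ => U.indicator a (p + s • -v)) (𝓝[>] 0) (𝓝 l)) :
    Tendsto (fun s : ℝ => U.indicator a (p + s • v)) (𝓝[<] 0) (𝓝 l) := by
  have hneg : Tendsto Neg.neg (𝓝[<] (0 : ℝ)) (𝓝[>] 0) := by
    simpa only [neg_zero] using tendsto_neg_nhdsLT (a := (0 : ℝ))
  exact (h.comp hneg).congr fun s => by rw [Function.comp_apply, neg_smul_neg]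

variable [NormedSpace ℝ E]

theorem exists_jump (h : LiesLeft U p τ) (hv : cross v τ ≠ 0) (ha : ContinuousWithinAt a U p) :
    ∃ l, Tendsto (fun s : ℝ => U.indicator a (p + s • v)) (𝓝[<] 0) (𝓝 l) ∧
      Tendsto (fun s : ℝ => U.indicator a (p + s • v)) (𝓝[>] 0)
        (𝓝 (l + -((SignType.sign (cross v τ) : ℝ) • a p))) := by
  rcases hv.lt_or_gt with hneg | hpos
  · refine ⟨0, tendsto_indicator_nhdsLT (h.tendsto_indicator_nhdsGT_of_pos ?_), ?_⟩
    · rwa [cross_neg_left, neg_pos]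
    · rw [sign_neg hneg, SignType.coe_neg_one, neg_smul, one_smul, neg_neg, zero_add]
      exact h.tendsto_indicator_nhdsGT_of_neg hneg ha
  · refine ⟨a p, tendsto_indicator_nhdsLT (h.tendsto_indicator_nhdsGT_of_neg ?_ ha), ?_⟩
    · rwa [cross_neg_left, neg_lt_zero]
    · rw [sign_pos hpos, SignType.coe_one, one_smul, add_neg_cancel]
      exact h.tendsto_indicator_nhdsGT_of_pos hpos

end LiesLeft

/-- A function `φ` that is positive to the right and negative to the left of the curve `γ` with
velocity `τ` near `γ t₀`, and vanishes there on `γ` only. -/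
structure IsSideFunction (φ : SplitComplex → ℝ) (γ τ : ℝ → SplitComplex) (t₀ : ℝ) : Prop where
  eventually_hasDerivAt : ∀ᶠ t in 𝓝 t₀, φ (γ t) = 0 ∧
    ∃ k > 0, ∀ v, HasDerivAt (fun s : ℝ => φ (γ t + s • v)) (k * cross v (τ t)) 0
  exists_nhds : ∀ N ∈ 𝓝 (γ t₀), ∃ W ⊆ N, IsOpen W ∧ γ t₀ ∈ W ∧
    IsPreconnected (W ∩ {p | 0 < φ p}) ∧ IsPreconnected (W ∩ {p | φ p < 0}) ∧
      W ∩ {p | φ p = 0} ⊆ range γ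

namespace IsSideFunction

variable {φ : SplitComplex → ℝ} {γ τ : ℝ → SplitComplex} {t₀ : ℝ}

theorem neg (h : IsSideFunction φ γ τ t₀) :
    IsSideFunction (fun p => -φ p) γ (fun t => -τ t) t₀ where
  eventually_hasDerivAt := h.eventually_hasDerivAt.mono fun t ⟨hzero, k, hk, hderiv⟩ =>
    ⟨neg_eq_zero.2 hzero, k, hk, fun v => by simpa only [map_neg, mul_neg] using (hderiv v).fun_neg⟩
  exists_nhds N hN := by
    obtain ⟨W, hWN, hW, hmem, hpos, hneg, hzero⟩ := h.exists_nhds N hN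
    simp only [neg_pos, neg_lt_zero, neg_eq_zero]
    exact ⟨W, hWN, hW, hmem, hneg, hpos, hzero⟩

theorem eventually_mem_pos (h : IsSideFunction φ γ τ t₀) (hγ : ContinuousAt γ t₀)
    {W : Set SplitComplex} (hW : W ∈ 𝓝 (γ t₀)) :
    ∀ᶠ t in 𝓝 t₀, ∀ v, 0 < cross v (τ t) →
      ∀ᶠ s in 𝓝[>] (0 : ℝ), γ t + s • v ∈ W ∩ {p | 0 < φ p} := by
  filter_upwards [h.eventually_hasDerivAt, hγ.eventually (eventually_mem_nhds_iff.2 hW)]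
    with t ⟨hzero, k, hk, hderiv⟩ hWt v hv
  have hray : Tendsto (fun s : ℝ => γ t + s • v) (𝓝 0) (𝓝 (γ t)) := by
    have hcont : Continuous fun s : ℝ => γ t + s • v := by fun_prop
    exact hcont.tendsto' 0 _ (by rw [zero_smul, add_zero])
  have hsign := eventually_nhdsWithin_sign_eq_of_deriv_pos (x₀ := (0 : ℝ))
    (by rw [(hderiv v).deriv]; exact mul_pos hk hv) (by rwa [zero_smul, add_zero])
  filter_upwards [nhdsWithin_le_nhds (hray.eventually hWt), nhdsWithin_le_nhds hsign,
    self_mem_nhdsWithin] with s hsW hs hpos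
  rw [sub_zero, sign_pos (mem_Ioi.1 hpos), sign_eq_one_iff] at hs
  exact ⟨hsW, hs⟩

theorem eventually_mem_neg (h : IsSideFunction φ γ τ t₀) (hγ : ContinuousAt γ t₀)
    {W : Set SplitComplex} (hW : W ∈ 𝓝 (γ t₀)) :
    ∀ᶠ t in 𝓝 t₀, ∀ v, cross v (τ t) < 0 →
      ∀ᶠ s in 𝓝[>] (0 : ℝ), γ t + s • v ∈ W ∩ {p | φ p < 0} := by
  simpa only [map_neg, neg_pos] using h.neg.eventually_mem_pos hγ hW

theorem eventually_liesLeft (h : IsSideFunction φ γ τ t₀) (hγ : ContinuousAt γ t₀)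
    {U : Set SplitComplex} (hU : IsOpen U) (hrange : range γ ⊆ frontier U)
    (hfrontier : ∀ᶠ p in 𝓝 (γ t₀), p ∈ frontier U → φ p = 0) {n : SplitComplex}
    (hn : 0 < cross n (τ t₀)) (hout : ∀ᶠ s in 𝓝[>] (0 : ℝ), γ t₀ + s • n ∉ U) :
    ∀ᶠ t in 𝓝 t₀, LiesLeft U (γ t) (τ t) := by
  obtain ⟨W, hWN, hW, hmem, hpos, hneg, hzero⟩ := h.exists_nhds _ hfrontier
  have hWγ := hW.mem_nhds hmem
  have hright : Disjoint (W ∩ {p | 0 < φ p}) U := by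
    refine (isPreconnected_subset_or_disjoint hpos hU (disjoint_left.2 fun p hp hpU =>
      ne_of_gt hp.2 (hWN hp.1 hpU))).resolve_left fun hsub => ?_
    obtain ⟨s, hs, hsU⟩ := (((h.eventually_mem_pos hγ hWγ).self_of_nhds n hn).and hout).exists
    exact hsU (hsub hs)
  have hleft : W ∩ {p | φ p < 0} ⊆ U := by
    refine (isPreconnected_subset_or_disjoint hneg hU (disjoint_left.2 fun p hp hpU =>
      ne_of_lt hp.2 (hWN hp.1 hpU))).resolve_right fun hdisj => ?_
    obtain ⟨q, hqW, hqU⟩ := mem_closure_iff.1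
      (frontier_subset_closure (hrange (mem_range_self t₀))) W hW hmem
    rcases lt_trichotomy (φ q) 0 with hlt | heq | hgt
    · exact disjoint_left.1 hdisj ⟨hqW, hlt⟩ hqU
    · exact disjoint_left.1 (disjoint_frontier_iff_isOpen.2 hU) (hrange (hzero ⟨hqW, heq⟩)) hqU
    · exact disjoint_left.1 hright ⟨hqW, hgt⟩ hqU
  filter_upwards [h.eventually_mem_pos hγ hWγ, h.eventually_mem_neg hγ hWγ] with t htpos htneg
  exact ⟨fun v hv => (htpos v hv).mono fun s hs => disjoint_left.1 hright hs,
    fun v hv => (htneg v hv).mono fun s hs => hleft hs⟩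

end IsSideFunction

section Tube

/-- The map that spreads the curve `γ` in the direction `ν`. Its local inverses provide the side
functions of `γ`. -/
def tube (γ : ℝ → SplitComplex) (ν : SplitComplex) (x : ℝ × ℝ) : SplitComplex := γ x.1 + x.2 • ν

variable {γ : ℝ → SplitComplex} {ν : SplitComplex}

theorem tube_zero (t : ℝ) : tube γ ν (t, 0) = γ t := by rw [tube, zero_smul, add_zero]

theorem hasStrictFDerivAt_tube {w : SplitComplex} {t : ℝ} (hγ : HasStrictDerivAt γ w t)
    (hw : cross ν w ≠ 0) (s : ℝ) :
    HasStrictFDerivAt (tube γ ν) (frame w ν hw : (ℝ × ℝ) →L[ℝ] SplitComplex) (t, s) := by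
  have hcurve : HasStrictFDerivAt (fun x : ℝ × ℝ => γ x.1) _ (t, s) :=
    HasStrictFDerivAt.comp (t, s) (g := γ) hγ.hasStrictFDerivAt
      (hasStrictFDerivAt_fst (𝕜 := ℝ) (E := ℝ) (F := ℝ))
  have hsegment : HasStrictFDerivAt (fun x : ℝ × ℝ => x.2 • ν) _ (t, s) :=
    (hasStrictFDerivAt_snd (𝕜 := ℝ) (E := ℝ) (F := ℝ)).smul_const ν
  refine (hcurve.add hsegment).congr_fderiv ?_
  ext <;> simp [frame_apply]

variable {e : OpenPartialHomeomorph (ℝ × ℝ) SplitComplex} {t : ℝ}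

theorem symm_apply_of_eq_tube (he : ⇑e = tube γ ν) (ht : (t, 0) ∈ e.source) :
    e.symm (γ t) = (t, 0) := by
  rw [← tube_zero (γ := γ) (ν := ν) t, ← he, e.left_inv ht]

theorem hasDerivAt_snd_symm_of_eq_tube (he : ⇑e = tube γ ν) (ht : (t, 0) ∈ e.source)
    {w : SplitComplex} (hγ : HasStrictDerivAt γ w t) (hw : cross ν w ≠ 0) (v : SplitComplex) :
    HasDerivAt (fun s : ℝ => (e.symm (γ t + s • v)).2) ((cross ν w)⁻¹ * cross v w) 0 := by
  have htarget : γ t ∈ e.target := by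
    rw [← tube_zero (γ := γ) (ν := ν) t, ← he]
    exact e.map_source ht
  have hsymm : HasStrictFDerivAt e.symm
      ((frame w ν hw).symm : SplitComplex →L[ℝ] ℝ × ℝ) (γ t) := by
    refine e.hasStrictFDerivAt_symm htarget ?_
    rw [symm_apply_of_eq_tube he ht, he]
    exact hasStrictFDerivAt_tube hγ hw 0
  have hline : HasDerivAt (fun s : ℝ => γ t + s • v) v 0 := by
    simpa only [one_smul] using ((hasDerivAt_id' (0 : ℝ)).smul_const v).const_add (γ t)
  have hsymm' := HasFDerivAt.comp_hasDerivAt_of_eq (0 : ℝ) hsymm.hasFDerivAt hline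
    (by rw [zero_smul, add_zero])
  have hsnd := (hasFDerivAt_snd (𝕜 := ℝ) (E := ℝ) (F := ℝ)).comp_hasDerivAt (0 : ℝ) hsymm'
  rw [inv_mul_eq_div]
  exact hsnd

theorem exists_nhds_of_eq_tube (he : ⇑e = tube γ ν) (ht : (t, 0) ∈ e.source)
    {N : Set SplitComplex} (hN : N ∈ 𝓝 (γ t)) :
    ∃ W ⊆ N, IsOpen W ∧ γ t ∈ W ∧ IsPreconnected (W ∩ {p | 0 < (e.symm p).2}) ∧
      IsPreconnected (W ∩ {p | (e.symm p).2 < 0}) ∧ W ∩ {p | (e.symm p).2 = 0} ⊆ range γ := by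
  have htube : e (t, 0) = γ t := by rw [he, tube_zero]
  obtain ⟨r, hr, hball⟩ := Metric.mem_nhds_iff.1 (inter_mem (e.open_source.mem_nhds ht)
    ((e.continuousAt ht).preimage_mem_nhds (by rwa [htube])))
  set b := Metric.ball (t, (0 : ℝ)) r
  have hsource : b ⊆ e.source := hball.trans inter_subset_left
  have hinter : ∀ S : Set ℝ, e '' b ∩ {p | (e.symm p).2 ∈ S} = e '' (b ∩ {x | x.2 ∈ S}) := by
    intro S
    refine subset_antisymm ?_ ?_
    · rintro _ ⟨⟨x, hx, rfl⟩, hxS⟩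
      rw [mem_ofPred_eq, e.left_inv (hsource hx)] at hxS
      exact ⟨x, ⟨hx, hxS⟩, rfl⟩
    · rintro _ ⟨x, ⟨hx, hxS⟩, rfl⟩
      refine ⟨mem_image_of_mem e hx, ?_⟩
      rwa [mem_ofPred_eq, e.left_inv (hsource hx)]
  have hpreconnected : ∀ S : Set ℝ, Convex ℝ {x : ℝ × ℝ | x.2 ∈ S} →
      IsPreconnected (e '' b ∩ {p | (e.symm p).2 ∈ S}) := fun S hS => by
    rw [hinter S]
    exact ((convex_ball _ _).inter hS).isPreconnected.image e
      (e.continuousOn.mono (inter_subset_left.trans hsource))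
  refine ⟨e '' b, image_subset_iff.2 (hball.trans inter_subset_right),
    e.isOpen_image_of_subset_source Metric.isOpen_ball hsource,
    ⟨(t, 0), Metric.mem_ball_self hr, htube⟩,
    hpreconnected (Ioi 0) (convex_halfSpace_gt (LinearMap.snd ℝ ℝ ℝ).isLinear 0),
    hpreconnected (Iio 0) (convex_halfSpace_lt (LinearMap.snd ℝ ℝ ℝ).isLinear 0), ?_⟩
  refine (hinter {0}).subset.trans ?_
  rintro _ ⟨⟨s, u⟩, ⟨-, rfl⟩, rfl⟩
  exact ⟨s, by rw [he, tube_zero]⟩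

theorem exists_isSideFunction {τ : ℝ → SplitComplex} {t₀ : ℝ}
    (hγ : ∀ᶠ t in 𝓝 t₀, HasStrictDerivAt γ (τ t) t) (hτ : ContinuousAt τ t₀) (hτ0 : τ t₀ ≠ 0) :
    ∃ φ, IsSideFunction φ γ τ t₀ := by
  have hcross := cross_rotate_pos hτ0
  have htube := hasStrictFDerivAt_tube hγ.self_of_nhds hcross.ne' 0
  set e := htube.toOpenPartialHomeomorph (tube γ (rotate (τ t₀)))
  have he : ⇑e = tube γ (rotate (τ t₀)) := htube.toOpenPartialHomeomorph_coe
  have hsource : ∀ᶠ t in 𝓝 t₀, (t, (0 : ℝ)) ∈ e.source :=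
    (Continuous.prodMk_left (0 : ℝ)).continuousAt.eventually
      (e.open_source.mem_nhds htube.mem_toOpenPartialHomeomorph_source)
  refine ⟨fun p => (e.symm p).2, ?_, fun N hN => exists_nhds_of_eq_tube he hsource.self_of_nhds hN⟩
  have hpos : ∀ᶠ t in 𝓝 t₀, 0 < cross (rotate (τ t₀)) (τ t) :=
    ((cross (rotate (τ t₀))).continuous.continuousAt.comp hτ).eventually (lt_mem_nhds hcross)
  filter_upwards [hγ, hsource, hpos] with t hγt ht hνt
  exact ⟨by rw [symm_apply_of_eq_tube he ht], _, inv_pos.2 hνt,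
    hasDerivAt_snd_symm_of_eq_tube he ht hγt hνt.ne'⟩

end Tube

/-! ### The oriented boundary -/

namespace PiecewiseSmoothBoundary

variable {U : Set SplitComplex} (B : PiecewiseSmoothBoundary U)

theorem hasStrictDerivAt_arc (i : Fin B.card) {t : ℝ} (ht : t ∈ Ioo (0 : ℝ) 1) :
    HasStrictDerivAt (B.arc i).extend (velocity (B.arc i) t) t := by
  have hI : I ∈ 𝓝 t := Icc_mem_nhds ht.1 ht.2
  rw [velocity, derivWithin_of_mem_nhds hI]
  exact ((B.smooth i).contDiffAt hI).hasStrictDerivAt (by simp)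

theorem continuousOn_velocity (i : Fin B.card) : ContinuousOn (velocity (B.arc i)) I :=
  (B.smooth i).continuousOn_derivWithin (uniqueDiffOn_Icc zero_lt_one) (by simp)

theorem range_arc_extend_subset_frontier (i : Fin B.card) :
    range (B.arc i).extend ⊆ frontier U := by
  rw [Path.extend_range, ← B.iUnion_range]
  exact subset_iUnion (fun k => range (B.arc k)) i

theorem arc_extend_mem_frontier (i : Fin B.card) (t : ℝ) : (B.arc i).extend t ∈ frontier U :=
  B.range_arc_extend_subset_frontier i (mem_range_self t)

theorem continuous_comp_arc_extend {X : Type*} [TopologicalSpace X] {a : SplitComplex → X}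
    (ha : ContinuousOn a (closure U)) (i : Fin B.card) :
    Continuous fun t => a ((B.arc i).extend t) :=
  ha.comp_continuous (B.arc i).continuous_extend fun t =>
    frontier_subset_closure (B.arc_extend_mem_frontier i t)

theorem eq_and_eq_of_arc_extend_eq {i k : Fin B.card} {s t : ℝ} (ht : t ∈ Ioo (0 : ℝ) 1)
    (hs : s ∈ I) (h : (B.arc i).extend t = (B.arc k).extend s) : i = k ∧ t = s := by
  have htI : t ∈ I := Ioo_subset_Icc_self ht
  rw [Path.extend_apply _ htI, Path.extend_apply _ hs] at h
  exact (B.simple i k ⟨s, hs⟩ ⟨t, htI⟩ ht h).imp_right (congrArg Subtype.val)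

theorem exists_arc_extend_eq {p : SplitComplex} (hp : p ∈ frontier U) :
    ∃ i, ∃ t ∈ I, (B.arc i).extend t = p := by
  rw [← B.iUnion_range] at hp
  obtain ⟨i, t, rfl⟩ := mem_iUnion.1 hp
  exact ⟨i, t, t.2, Path.extend_apply _ t.2⟩

theorem exists_isOutwardNormal (i : Fin B.card) {t : ℝ} (ht : t ∈ Ioo (0 : ℝ) 1) :
    ∃ n, IsOutwardNormal U ((B.arc i).extend t) (velocity (B.arc i) t) n := by
  rw [Path.extend_apply _ (Ioo_subset_Icc_self ht)]
  exact B.exists_outward i ⟨t, Ioo_subset_Icc_self ht⟩ ht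

theorem eventually_frontier_exists_arc_extend_eq (i : Fin B.card) {t₀ : ℝ}
    (ht₀ : t₀ ∈ Ioo (0 : ℝ) 1) {P : ℝ → Prop} (hP : ∀ᶠ t in 𝓝 t₀, P t) :
    ∀ᶠ p in 𝓝 ((B.arc i).extend t₀), p ∈ frontier U → ∃ t, P t ∧ (B.arc i).extend t = p := by
  obtain ⟨J, hJP, hJ, hJt⟩ := eventually_nhds_iff.1 hP
  set K : Fin B.card → Set ℝ := fun k => I \ ⋃ _ : k = i, J
  have hKclosed : IsClosed (⋃ k, (B.arc k).extend '' K k) := (isCompact_iUnion fun k =>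
    (isCompact_Icc.diff (isOpen_iUnion fun _ => hJ)).image (B.arc k).continuous_extend).isClosed
  have hnotMem : (B.arc i).extend t₀ ∉ ⋃ k, (B.arc k).extend '' K k := by
    intro hmem
    obtain ⟨k, s, ⟨hsI, hsJ⟩, heq⟩ := mem_iUnion.1 hmem
    obtain ⟨rfl, rfl⟩ := B.eq_and_eq_of_arc_extend_eq ht₀ hsI heq.symm
    exact hsJ (mem_iUnion.2 ⟨rfl, hJt⟩)
  filter_upwards [hKclosed.isOpen_compl.mem_nhds hnotMem] with p hpK hp
  obtain ⟨k, s, hs, rfl⟩ := B.exists_arc_extend_eq hp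
  obtain ⟨rfl, hsJ⟩ : ∃ _ : k = i, s ∈ J := by
    by_contra hne
    exact hpK (mem_iUnion_of_mem k (mem_image_of_mem _ ⟨hs, fun h => hne (mem_iUnion.1 h)⟩))
  exact ⟨s, hJP s hsJ, rfl⟩

theorem eventually_liesLeft_or_eventually_liesLeft_neg (hU : IsOpen U) (i : Fin B.card) {t₀ : ℝ}
    (ht₀ : t₀ ∈ Ioo (0 : ℝ) 1) :
    (∀ᶠ t in 𝓝 t₀, LiesLeft U ((B.arc i).extend t) (velocity (B.arc i) t)) ∨
      ∀ᶠ t in 𝓝 t₀, LiesLeft U ((B.arc i).extend t) (-velocity (B.arc i) t) := by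
  have hregular := B.regular i t₀ (Ioo_subset_Icc_self ht₀)
  obtain ⟨φ, hφ⟩ := exists_isSideFunction
    (Filter.mem_of_superset (Ioo_mem_nhds ht₀.1 ht₀.2) fun t ht => B.hasStrictDerivAt_arc i ht)
    ((B.continuousOn_velocity i).continuousAt (Icc_mem_nhds ht₀.1 ht₀.2)) hregular
  have hγ := (B.arc i).continuous_extend.continuousAt (x := t₀)
  have hrange := B.range_arc_extend_subset_frontier i
  have hfrontier : ∀ᶠ p in 𝓝 ((B.arc i).extend t₀), p ∈ frontier U → φ p = 0 := by
    filter_upwards [B.eventually_frontier_exists_arc_extend_eq i ht₀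
      (hφ.eventually_hasDerivAt.mono fun t ht => ht.1)] with p hp hpU
    obtain ⟨t, ht, rfl⟩ := hp hpU
    exact ht
  obtain ⟨n, hn⟩ := B.exists_isOutwardNormal i ht₀
  rcases (cross_ne_zero_of_perp hn.ne_zero hregular hn.perp).lt_or_gt with hneg | hpos
  · refine Or.inr (hφ.neg.eventually_liesLeft hγ hU hrange ?_ ?_ hn.outside)
    · simpa only [neg_eq_zero] using hfrontier
    · rwa [map_neg, neg_pos]
  · exact Or.inl (hφ.eventually_liesLeft hγ hU hrange hfrontier hpos hn.outside)

theorem forall_liesLeft_or_forall_liesLeft_neg (hU : IsOpen U) (i : Fin B.card) :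
    (∀ t ∈ Ioo (0 : ℝ) 1, LiesLeft U ((B.arc i).extend t) (velocity (B.arc i) t)) ∨
      ∀ t ∈ Ioo (0 : ℝ) 1, LiesLeft U ((B.arc i).extend t) (-velocity (B.arc i) t) := by
  by_contra! hcon
  obtain ⟨⟨s, hs, hsl⟩, ⟨u, hu, hur⟩⟩ := hcon
  have hcover := fun t ht => B.eventually_liesLeft_or_eventually_liesLeft_neg hU i (t₀ := t) ht
  obtain ⟨t, ht, hleft, hright⟩ := isPreconnected_Ioo _ _ isOpen_setOfPred_eventually_nhds
    isOpen_setOfPred_eventually_nhds hcover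
    ⟨u, hu, (hcover u hu).resolve_right fun h => hur h.self_of_nhds⟩
    ⟨s, hs, (hcover s hs).resolve_left fun h => hsl h.self_of_nhds⟩
  exact hleft.self_of_nhds.not_liesLeft_neg (B.regular i t (Ioo_subset_Icc_self ht))
    hright.self_of_nhds

/-- The velocity of the `i`-th arc, reversed if necessary to agree with the canonical orientation
of `∂U`. -/
noncomputable def positiveTangent (i : Fin B.card) (t : ℝ) : SplitComplex :=
  B.orientationSign i • velocity (B.arc i) t

theorem continuousOn_positiveTangent (i : Fin B.card) : ContinuousOn (B.positiveTangent i) I :=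
  (B.continuousOn_velocity i).const_smul (B.orientationSign i)

theorem liesLeft_positiveTangent (hU : IsOpen U) (i : Fin B.card) {t : ℝ}
    (ht : t ∈ Ioo (0 : ℝ) 1) : LiesLeft U ((B.arc i).extend t) (B.positiveTangent i t) := by
  rw [positiveTangent, orientationSign]
  rcases B.forall_liesLeft_or_forall_liesLeft_neg hU i with h | h
  · rw [if_pos, one_smul]
    · exact h t ht
    · intro s hs
      rw [← Path.extend_apply]
      exact (h s hs).isPositiveDirection (B.regular i s s.2)
  · rw [if_neg, neg_one_smul]
    · exact h t ht
    · intro hpos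
      have hdir := hpos ⟨t, Ioo_subset_Icc_self ht⟩ ht
      rw [← Path.extend_apply] at hdir
      exact (h t ht).not_isPositiveDirection hdir

theorem abs_cross_positiveTangent (i : Fin B.card) (v : SplitComplex) (t : ℝ) :
    |cross v (B.positiveTangent i t)| = |cross v (velocity (B.arc i) t)| := by
  rw [positiveTangent, orientationSign]
  split_ifs
  · rw [one_smul]
  · rw [neg_one_smul, map_neg, abs_neg]

end PiecewiseSmoothBoundary

/-! ### Slices by parallel lines -/

section Slices

open MeasureTheory

/-- If `cross v w = 1`, this is the line on which `cross v` takes the value `c`, parametrized by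
the values of `cross · w`. -/
def levelLine (v w : SplitComplex) (c x : ℝ) : SplitComplex := c • w + x • v

variable {v w : SplitComplex} {c : ℝ}

theorem levelLine_add (x s : ℝ) : levelLine v w c (x + s) = levelLine v w c x + s • v := by
  rw [levelLine, levelLine, add_smul, add_assoc]

theorem cross_levelLine (hvw : cross v w = 1) (x : ℝ) : cross v (levelLine v w c x) = c := by
  rw [levelLine, map_add, map_smul, map_smul, hvw, cross_self, smul_zero, add_zero, smul_eq_mul,
    mul_one]

theorem cross_levelLine_left (hvw : cross v w = 1) (x : ℝ) : cross (levelLine v w c x) w = x := by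
  rw [levelLine, cross_add_left, cross_smul_left, cross_smul_left, hvw, cross_self, mul_zero,
    zero_add, mul_one]

theorem levelLine_cross_left (hvw : cross v w = 1) {p : SplitComplex} (hp : cross v p = c) :
    levelLine v w c (cross p w) = p := by
  rw [levelLine, ← hp, ← cross_smul_eq, hvw, one_smul]

theorem exists_abs_cross_lt {s : Set SplitComplex} (hs : Bornology.IsBounded s)
    (w : SplitComplex) : ∃ R > 0, ∀ p ∈ s, |cross p w| < R := by
  obtain ⟨R, hR, hbound⟩ := ((cross w).lipschitz.isBounded_image hs).exists_pos_norm_lt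
  refine ⟨R, hR, fun p hp => ?_⟩
  rw [cross_swap, abs_neg]
  exact hbound _ (mem_image_of_mem _ hp)

variable {E : Type*} [NormedAddCommGroup E] [NormedSpace ℝ E] {U : Set SplitComplex}
  {a : SplitComplex → E}

theorem hasDerivAt_indicator_levelLine (hU : IsOpen U) (ha : ∀ Z ∈ U, HasLineDerivAt ℝ a 0 Z v)
    {x : ℝ} (hx : levelLine v w c x ∉ frontier U) :
    HasDerivAt (fun y => U.indicator a (levelLine v w c y)) 0 x := by
  have hline := hasLineDerivAt_indicator_zero hU ha hx
  rw [HasLineDerivAt, ← sub_self x] at hline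
  refine (hline.comp_sub_const x x).congr_of_eventuallyEq (.of_forall fun y => ?_)
  simp only [← levelLine_add, add_sub_cancel]

theorem LiesLeft.exists_jump_levelLine {p τ : SplitComplex} (h : LiesLeft U p τ)
    (hvw : cross v w = 1) (hp : cross v p = c) (hv : cross v τ ≠ 0)
    (ha : ContinuousWithinAt a U p) :
    ∃ l, Tendsto (fun x => U.indicator a (levelLine v w c x)) (𝓝[<] cross p w) (𝓝 l) ∧
      Tendsto (fun x => U.indicator a (levelLine v w c x)) (𝓝[>] cross p w)
        (𝓝 (l + -((SignType.sign (cross v τ) : ℝ) • a p))) := by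
  have hcont : Continuous fun x => x - cross p w := continuous_sub_right _
  have hleft : Tendsto (fun x => x - cross p w) (𝓝[<] cross p w) (𝓝[<] 0) := by
    simpa only [sub_self] using
      (hcont.continuousWithinAt (x := cross p w)).tendsto_nhdsWithin (s := Iio _) (t := Iio 0)
        fun x hx => sub_neg.2 hx
  have hright : Tendsto (fun x => x - cross p w) (𝓝[>] cross p w) (𝓝[>] 0) := by
    simpa only [sub_self] using
      (hcont.continuousWithinAt (x := cross p w)).tendsto_nhdsWithin (s := Ioi _) (t := Ioi 0)
        fun x hx => sub_pos.2 hx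
  have hshift : ∀ x, p + (x - cross p w) • v = levelLine v w c x := fun x => by
    rw [← add_sub_cancel (cross p w) x, levelLine_add, levelLine_cross_left hvw hp,
      add_sub_cancel]
  obtain ⟨l, hl, hr⟩ := h.exists_jump hv ha
  exact ⟨l, (hl.comp hleft).congr fun x => by rw [Function.comp_apply, hshift],
    (hr.comp hright).congr fun x => by rw [Function.comp_apply, hshift]⟩

namespace PiecewiseSmoothBoundary

/-- The value `c` of the functional `cross v` is regular if the arcs attain it at interior points
only and are transversal to its level line. -/
def IsRegularValue (B : PiecewiseSmoothBoundary U) (v : SplitComplex) (c : ℝ) : Prop :=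
  ∀ i, ∀ t ∈ I, cross v ((B.arc i).extend t) = c →
    t ∈ Ioo (0 : ℝ) 1 ∧ cross v (velocity (B.arc i) t) ≠ 0

variable {B : PiecewiseSmoothBoundary U}

theorem hasDerivAt_cross_arc (v : SplitComplex) (i : Fin B.card) {t : ℝ}
    (ht : t ∈ Ioo (0 : ℝ) 1) :
    HasDerivAt (fun t => cross v ((B.arc i).extend t)) (cross v (velocity (B.arc i) t)) t :=
  (cross v).hasFDerivAt.comp_hasDerivAt t (B.hasStrictDerivAt_arc i ht).hasDerivAt

variable (B v) in
theorem ae_isRegularValue : ∀ᵐ c, B.IsRegularValue v c := by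
  have hvelocity : ∀ᵐ c : ℝ, ∀ i, ∀ t ∈ Ioo (0 : ℝ) 1, cross v ((B.arc i).extend t) = c →
      cross v (velocity (B.arc i) t) ≠ 0 := ae_all_iff.2 fun i =>
    ae_forall_deriv_ne_zero_of_eq fun t ht => (hasDerivAt_cross_arc v i ht).hasDerivWithinAt
  have hendpoints : ∀ᵐ c : ℝ, ∀ i : Fin B.card,
      cross v ((B.arc i).extend 0) ≠ c ∧ cross v ((B.arc i).extend 1) ≠ c :=
    ae_all_iff.2 fun i => ((Measure.ae_ne volume _).mono fun _ => Ne.symm).and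
      ((Measure.ae_ne volume _).mono fun _ => Ne.symm)
  filter_upwards [hvelocity, hendpoints] with c hcv hce i t ht htc
  have htIoo : t ∈ Ioo (0 : ℝ) 1 :=
    ⟨ht.1.lt_of_ne' fun h => (hce i).1 (h ▸ htc), ht.2.lt_of_ne fun h => (hce i).2 (h ▸ htc)⟩
  exact ⟨htIoo, hcv i t htIoo htc⟩

namespace IsRegularValue

theorem finite_fiber (hc : B.IsRegularValue v c) (i : Fin B.card) :
    (Ioo (0 : ℝ) 1 ∩ (fun t => cross v ((B.arc i).extend t)) ⁻¹' {c}).Finite :=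
  (finite_inter_preimage_singleton_of_hasDerivWithinAt isCompact_Icc
    ((cross v).continuous.comp (B.arc i).continuous_extend).continuousOn fun t ht htc =>
      ⟨(hasDerivAt_cross_arc v i (hc i t ht htc).1).hasDerivWithinAt, (hc i t ht htc).2⟩).subset
    (inter_subset_inter_left _ Ioo_subset_Icc_self)

theorem sum_fiberSum_sign_smul_eq_zero [CompleteSpace E] (hc : B.IsRegularValue v c)
    (hv : v ≠ 0) (hU : IsOpen U) (hUb : Bornology.IsBounded U) (hac : ContinuousOn a (closure U))
    (ha : ∀ Z ∈ U, HasLineDerivAt ℝ a 0 Z v) :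
    ∑ i, fiberSum (fun t => cross v ((B.arc i).extend t)) (Ioo 0 1) (fun t =>
      (SignType.sign (cross v (B.positiveTangent i t)) : ℝ) • a ((B.arc i).extend t)) c = 0 := by
  obtain ⟨w, hvw⟩ := exists_cross_eq_one hv
  have := fun i => (hc.finite_fiber i).fintype
  set pos : (Σ i, ↥(Ioo (0 : ℝ) 1 ∩ (fun t => cross v ((B.arc i).extend t)) ⁻¹' {c})) → ℝ :=
    fun q => cross ((B.arc q.1).extend q.2) w
  have hline : ∀ q, levelLine v w c (pos q) = (B.arc q.1).extend q.2 := fun q =>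
    levelLine_cross_left hvw q.2.2.2
  obtain ⟨R, hR, hbound⟩ := exists_abs_cross_lt hUb.closure w
  have hpos : Function.Injective pos := by
    rintro ⟨i, s, hs⟩ ⟨k, t, ht⟩ hst
    have heq := (hline ⟨i, s, hs⟩).symm.trans ((congrArg _ hst).trans (hline ⟨k, t, ht⟩))
    obtain ⟨rfl, rfl⟩ := B.eq_and_eq_of_arc_extend_eq hs.1 (Ioo_subset_Icc_self ht.1) heq
    rfl
  have hmem : ∀ q, |pos q| < R := fun q =>
    hbound _ (frontier_subset_closure (B.arc_extend_mem_frontier _ _))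
  have hend : ∀ x, |x| = R → U.indicator a (levelLine v w c x) = 0 := fun x hx =>
    indicator_of_notMem (fun hxU => (hbound _ (subset_closure hxU)).ne
      (by rwa [cross_levelLine_left hvw])) a
  have hsum := sub_eq_sum_of_hasDerivAt_zero_of_jump hpos
    (h := fun x => U.indicator a (levelLine v w c x)) (a := -R) (b := R)
    (J := fun q => -((SignType.sign (cross v (B.positiveTangent q.1 q.2)) : ℝ) •
      a ((B.arc q.1).extend q.2)))
    (fun x hx => hasDerivAt_indicator_levelLine hU ha fun hfrontier => ?_)
    (fun q => (B.liesLeft_positiveTangent hU q.1 q.2.2.1).exists_jump_levelLine hvw q.2.2.2 ?_ ?_)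
    (neg_le_self hR.le) (fun q => (abs_lt.1 (hmem q)).1) (fun q => (abs_lt.1 (hmem q)).2)
  · rw [hend R (abs_of_pos hR), hend (-R) (by rw [abs_neg, abs_of_pos hR]), sub_zero,
      Finset.sum_neg_distrib, zero_eq_neg, Fintype.sum_sigma] at hsum
    simpa only [fiberSum, tsum_fintype] using hsum
  · obtain ⟨i, t, ht, hit⟩ := B.exists_arc_extend_eq hfrontier
    have htc : cross v ((B.arc i).extend t) = c := by rw [hit, cross_levelLine hvw]
    refine hx ⟨⟨i, t, (hc i t ht htc).1, htc⟩, ?_⟩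
    change cross ((B.arc i).extend t) w = x
    rw [hit, cross_levelLine_left hvw]
  · rw [← abs_ne_zero, abs_cross_positiveTangent, abs_ne_zero]
    exact (hc q.1 q.2 (Ioo_subset_Icc_self q.2.2.1) q.2.2.2).2
  · exact (hac _ (frontier_subset_closure (B.arc_extend_mem_frontier _ _))).mono subset_closure

end IsRegularValue

variable (B) in
theorem sum_integral_cross_positiveTangent_smul_eq_zero [CompleteSpace E] (hv : v ≠ 0)
    (hU : IsOpen U) (hUb : Bornology.IsBounded U) (hac : ContinuousOn a (closure U))
    (ha : ∀ Z ∈ U, HasLineDerivAt ℝ a 0 Z v) :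
    ∑ i, ∫ t in (0 : ℝ)..1, cross v (B.positiveTangent i t) • a ((B.arc i).extend t) = 0 := by
  set g : Fin B.card → ℝ → E := fun i t =>
    (SignType.sign (cross v (B.positiveTangent i t)) : ℝ) • a ((B.arc i).extend t)
  have habs : ∀ i t, |cross v (velocity (B.arc i) t)| • g i t =
      cross v (B.positiveTangent i t) • a ((B.arc i).extend t) := fun i t => by
    rw [← abs_cross_positiveTangent, smul_smul, abs_mul_sign]
  have hint : ∀ i, IntegrableOn (fun t => |cross v (velocity (B.arc i) t)| • g i t) (Ioo 0 1) := by
    intro i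
    simp only [habs]
    have hcont : ContinuousOn
        (fun t => cross v (B.positiveTangent i t) • a ((B.arc i).extend t)) I :=
      ((cross v).continuous.comp_continuousOn (B.continuousOn_positiveTangent i)).smul
        (B.continuous_comp_arc_extend hac i).continuousOn
    exact (hcont.integrableOn_compact isCompact_Icc).mono_set Ioo_subset_Icc_self
  have harea := fun i => integrable_fiberSum_and_integral_fiberSum_real measurableSet_Ioo
    (fun t ht => (hasDerivAt_cross_arc v i ht).hasDerivWithinAt) (hint i)
  calc ∑ i, ∫ t in (0 : ℝ)..1, cross v (B.positiveTangent i t) • a ((B.arc i).extend t)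
      = ∑ i, ∫ c, fiberSum (fun t => cross v ((B.arc i).extend t)) (Ioo 0 1) (g i) c :=
        Finset.sum_congr rfl fun i _ => by
          rw [(harea i).2, intervalIntegral.integral_of_le zero_le_one,
            integral_Ioc_eq_integral_Ioo]
          simp only [habs]
    _ = ∫ c, ∑ i, fiberSum (fun t => cross v ((B.arc i).extend t)) (Ioo 0 1) (g i) c :=
        (integral_finsetSum _ fun i _ => (harea i).1).symm
    _ = 0 := integral_eq_zero_of_ae <| (B.ae_isRegularValue v).mono fun c hc =>
        hc.sum_fiberSum_sign_smul_eq_zero hv hU hUb hac ha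

end PiecewiseSmoothBoundary

end Slices

/-! ### The two characters of the algebra -/

theorem dZ_apply (τ : SplitComplex) : dZ τ = τ := by
  change τ.re • (1 : SplitComplex) + τ.im • j = τ
  ext <;> simp [j, QuadraticAlgebra.re_one, QuadraticAlgebra.im_one]

theorem formMulDZ_apply (F : SplitComplex → SplitComplex) (Z τ : SplitComplex) :
    formMulDZ F Z τ = F Z * τ := by
  change F Z * dZ τ = F Z * τ
  rw [dZ_apply]

theorem continuousOn_mul {X : Type*} [TopologicalSpace X] {f g : X → SplitComplex} {s : Set X}
    (hf : ContinuousOn f s) (hg : ContinuousOn g s) : ContinuousOn (fun x => f x * g x) s := by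
  have hmul : (fun x => f x * g x) = fun x => reL (g x) • f x +
      imL (g x) • LinearMap.toContinuousLinearMap (LinearMap.mulLeft ℝ j) (f x) := by
    funext x
    change f x * g x = (g x).re • f x + (g x).im • (j * f x)
    ext
    · simp [j]; ring
    · simp [j]; ring
  rw [hmul]
  fun_prop

/-- The null vector `ε - j`, for `ε = 1` or `ε = -1`. It spans the kernel of the character
`x + j y ↦ x + ε y` of the algebra of split complex numbers, which is `cross (nullVector ε)`. -/
def nullVector (ε : ℝ) : SplitComplex := ⟨ε, -1⟩

theorem nullVector_ne_zero (ε : ℝ) : nullVector ε ≠ 0 := fun h =>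
  neg_ne_zero.2 one_ne_zero (congrArg QuadraticAlgebra.im h)

theorem nullVector_eq (ε : ℝ) : nullVector ε = ε • (1 : SplitComplex) - j := by
  ext <;> simp [nullVector, j, QuadraticAlgebra.re_one, QuadraticAlgebra.im_one]

theorem cross_nullVector (ε : ℝ) (Z : SplitComplex) :
    cross (nullVector ε) Z = Z.re + ε * Z.im := by
  rw [cross_apply, nullVector]; ring

theorem cross_nullVector_mul {ε : ℝ} (hε : ε * ε = 1) (Z W : SplitComplex) :
    cross (nullVector ε) (Z * W) = cross (nullVector ε) Z * cross (nullVector ε) W := by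
  simp only [cross_nullVector, QuadraticAlgebra.re_mul, QuadraticAlgebra.im_mul]
  linear_combination (-(Z.im * W.im)) * hε

theorem eq_zero_of_cross_nullVector {Z : SplitComplex} (h₁ : cross (nullVector 1) Z = 0)
    (h₂ : cross (nullVector (-1)) Z = 0) : Z = 0 := by
  rw [cross_nullVector] at h₁ h₂
  ext
  · rw [QuadraticAlgebra.re_zero]; linarith
  · rw [QuadraticAlgebra.im_zero]; linarith

theorem hasLineDerivAt_cross_nullVector_comp {ε : ℝ} (hε : ε * ε = 1)
    {F : SplitComplex → SplitComplex} {Z : SplitComplex} (hF : DifferentiableAt ℝ F Z)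
    (hdF : dPlus F Z = 0) :
    HasLineDerivAt ℝ (fun Z => cross (nullVector ε) (F Z)) 0 Z (nullVector ε) := by
  have hone : fderiv ℝ F Z 1 = j * fderiv ℝ F Z j := by
    rw [dPlus, hF.lineDeriv_eq_fderiv, hF.lineDeriv_eq_fderiv, smul_eq_zero] at hdF
    exact sub_eq_zero.1 (hdF.resolve_left (by norm_num))
  have hj : cross (nullVector ε) j = ε := by simp [cross_nullVector, j]
  have hzero : cross (nullVector ε) (fderiv ℝ F Z (nullVector ε)) = 0 := by
    rw [nullVector_eq, map_sub, map_sub, map_smul, map_smul, ← nullVector_eq, hone,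
      cross_nullVector_mul hε, hj, smul_eq_mul, ← mul_assoc, hε, one_mul, sub_self]
  have hline :=
    ((cross (nullVector ε)).hasFDerivAt.comp Z hF.hasFDerivAt).hasLineDerivAt (nullVector ε)
  rw [ContinuousLinearMap.comp_apply, hzero] at hline
  exact hline

namespace PiecewiseSmoothBoundary

variable {U : Set SplitComplex} (B : PiecewiseSmoothBoundary U)

theorem cross_nullVector_smul_curveIntegral {F : SplitComplex → SplitComplex}
    (hF : ContinuousOn F (closure U)) {ε : ℝ} (hε : ε * ε = 1) (i : Fin B.card) :
    cross (nullVector ε) (B.orientationSign i • curveIntegral (formMulDZ F) (B.arc i)) =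
      ∫ t in (0 : ℝ)..1, cross (nullVector ε) (B.positiveTangent i t) •
        cross (nullVector ε) (F ((B.arc i).extend t)) := by
  have hfun : curveIntegralFun (formMulDZ F) (B.arc i) =
      fun t => F ((B.arc i).extend t) * velocity (B.arc i) t := by
    funext t
    rw [curveIntegralFun_def, formMulDZ_apply]
    rfl
  have hcont : ContinuousOn (fun t => F ((B.arc i).extend t) * velocity (B.arc i) t) I :=
    continuousOn_mul (B.continuous_comp_arc_extend hF i).continuousOn
      (B.continuousOn_velocity i)
  rw [curveIntegral_def, hfun, map_smul,
    ← ContinuousLinearMap.intervalIntegral_comp_comm _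
      (hcont.intervalIntegrable_of_Icc zero_le_one), ← intervalIntegral.integral_smul]
  refine intervalIntegral.integral_congr fun t _ => ?_
  simp only [cross_nullVector_mul hε, positiveTangent, map_smul, smul_eq_mul]
  ring

theorem cross_nullVector_boundaryIntegral_eq_zero (hU : IsOpen U) (hUb : Bornology.IsBounded U)
    {F : SplitComplex → SplitComplex} (hF : ContinuousOn F (closure U))
    (hdiff : DifferentiableOn ℝ F U) (hdF : ∀ Z ∈ U, dPlus F Z = 0) {ε : ℝ} (hε : ε * ε = 1) :
    cross (nullVector ε) (B.boundaryIntegral F) = 0 := by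
  rw [boundaryIntegral, map_sum]
  simp only [B.cross_nullVector_smul_curveIntegral hF hε]
  exact B.sum_integral_cross_positiveTangent_smul_eq_zero (nullVector_ne_zero ε) hU hUb
    ((cross (nullVector ε)).continuous.comp_continuousOn hF) fun Z hZ =>
      hasLineDerivAt_cross_nullVector_comp hε (hdiff.differentiableAt (hU.mem_nhds hZ)) (hdF Z hZ)

end PiecewiseSmoothBoundary

end SplitComplex

theorem mainTheorem4_general {U : Set SplitComplex} (hU : IsOpen U) (hUb : Bornology.IsBounded U)
    (B : SplitComplex.PiecewiseSmoothBoundary U) {F : SplitComplex → SplitComplex}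
    (hF : ContinuousOn F (closure U)) (hdiff : DifferentiableOn ℝ F U)
    (hdF : ∀ Z ∈ U, SplitComplex.dPlus F Z = 0) :
    B.boundaryIntegral F = 0 :=
  SplitComplex.eq_zero_of_cross_nullVector
    (B.cross_nullVector_boundaryIntegral_eq_zero hU hUb hF hdiff hdF (by norm_num))
    (B.cross_nullVector_boundaryIntegral_eq_zero hU hUb hF hdiff hdF (by norm_num))

theorem mainTheorem4 (U : Set SplitComplex) (hU : IsOpen U) (hUb : Bornology.IsBounded U)
    (B : SplitComplex.PiecewiseSmoothBoundary U)
    (V : Set SplitComplex) (hV : IsOpen V) (hUV : closure U ⊆ V)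
    (F : SplitComplex → SplitComplex) (hF : ContDiffOn ℝ ∞ F V)
    (hdF : ∀ Z ∈ V, SplitComplex.dPlus F Z = 0) :
    B.boundaryIntegral F = 0 := by
  exact mainTheorem4_general hU hUb B (hF.continuousOn.mono hUV)
    ((hF.differentiableOn (by simp)).mono (subset_closure.trans hUV))
    fun Z hZ => hdF Z (hUV (subset_closure hZ))
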